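/- All algebras are associative, possibly non-unital algebras over $\mathbb{C}$ that are idempotent ($A^2=A$) and have a non-degenerate product; $M(A)$ is the multiplier algebra, and $\iota$ the identity map. A weak multiplier Hopf algebra (Van Daele–Wang) is such an algebra $A$ with a full coproduct $\Delta:A\to M(A\otimes A)$, that is, a homomorphism such that $T_1(a\otimes b)=\Delta(a)(1\otimes b)$ and $T_2(a\otimes b)=(a\otimes 1)\Delta(b)$ lie in $A\otimes A$ for all $a,b\in A$, which is coassociative, $(c\otimes 1\otimes 1)(\Delta\otimes\iota)(\Delta(a)(1\otimes b))=(\iota\otimes\Delta)((c\otimes 1)\Delta(a))(1\otimes 1\otimes b)$, and such that $\Delta(A)(1\otimes A)\subseteq V\otimes A$ or $(A\otimes 1)\Delta(A)\subseteq A\otimes V$ for a subspace $V\subseteq A$ forces $V=A$; with a counit $\varepsilon:A\to\mathbb{C}$, that is, a linear map with $(\varepsilon\otimes\iota)T_1(a\otimes b)=ab=(\iota\otimes\varepsilon)T_2(a\otimes b)$; and with an idempotent $E\in M(A\otimes A)$ such that $T_1(A\otimes A)=E(A\otimes A)$, $T_2(A\otimes A)=(A\otimes A)E$, $(\iota\otimes\Delta)E=(E\otimes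 1)(1\otimes E)=(1\otimes E)(E\otimes 1)$ (where $\iota\otimes\Delta$ is extended to $M(A\otimes A)$ with $(\iota\otimes\Delta)(1)=1\otimes E$), and $\ker T_i=(1-G_i)(A\otimes A)$ for $i=1,2$, where $G_1,G_2$ are the linear maps on $A\otimes A$ given by $(G_1\otimes\iota)(\Delta_{13}(a)(1\otimes b\otimes c))=\Delta_{13}(a)(1\otimes E)(1\otimes b\otimes c)$ and $(\iota\otimes G_2)((a\otimes b\otimes 1)\Delta_{13}(c))=(a\otimes b\otimes 1)(E\otimes 1)\Delta_{13}(c)$. It is regular if also $\Delta(a)(b\otimes 1)$ and $(1\otimes a)\Delta(b)$ always lie in $A\otimes A$ and $A$ with the flipped coproduct $\Delta^{cop}$ is again a weak multiplier Hopf algebra. We write $\Delta(a)=\sum a_{(1)}\otimes a_{(2)}$. Let $A$ and $B$ be regular weak multiplier Hopf algebras. A pairing of $A$ and $B$ is a bilinear form $\langle\cdot,\cdot\rangle:A\times B\to\mathbb{C}$ such that for all $a,a'\in A$, $b,b'\in B$ the multipliers $$a\rhd b=\sum b_{(1)}\langle a,b_{(2)}\rangle,\quad b\lhd a=\sum\langle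 a,b_{(1)}\rangle b_{(2)},\quad b\rhd a=\sum a_{(1)}\langle a_{(2)},b\rangle,\quad a\lhd b=\sum\langle a_{(1)},b\rangle a_{(2)}$$ lie in $B$, $B$, $A$, $A$ respectively; $$\langle a,a'\rhd b\rangle=\langle a',b\lhd a\rangle=\langle aa',b\rangle,\qquad \langle b'\rhd a,b\rangle=\langle a\lhd b,b'\rangle=\langle a,bb'\rangle;$$ the four linear maps $\varphi^l_{A,B}:a\otimes b\mapsto a\rhd b$, $\varphi^r_{A,B}:b\otimes a\mapsto b\lhd a$, $\varphi^l_{B,A}:b\otimes a\mapsto b\rhd a$, $\varphi^r_{B,A}:a\otimes b\mapsto a\lhd b$ are surjective onto $B,B,A,A$; and $\varepsilon_A(a)=\langle a,1\rangle$, $\varepsilon_B(b)=\langle 1,b\rangle$, i.e. $\varepsilon_A(b\rhd a)=\varepsilon_A(a\lhd b)=\langle a,b\rangle=\varepsilon_B(a\rhd b)=\varepsilon_B(b\lhd a)$. An algebra $R$ is a left $A$-module algebra if it is a left $A$-module that is unital ($A\rhd R=R$) and $$a\rhd(xy)=\sum(a_{(1)}\rhd x)(a_{(2)}\rhd y)\qquad(a\in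 A,\ x,y\in R),$$ where the right-hand side is the product applied to $\Delta(a)\rhd(x\otimes y)$: if $x\otimes y=\sum_i (p_i\rhd c_i)\otimes(q_i\rhd d_i)$ with $p_i,q_i\in A$, $c_i,d_i\in R$, then $\Delta(a)\rhd(x\otimes y)=\sum_i(\Delta(a)(p_i\otimes q_i))\rhd(c_i\otimes d_i)$. Right module algebras are defined in the same way, with $(xy)\lhd a=\sum(x\lhd a_{(1)})(y\lhd a_{(2)})$. **Proposition.** For every pairing of regular weak multiplier Hopf algebras $A$ and $B$, the four maps are actions: $(B,\varphi^l_{A,B})$ is a left $A$-module algebra, $(B,\varphi^r_{A,B})$ is a right $A$-module algebra, $(A,\varphi^l_{B,A})$ is a left $B$-module algebra, and $(A,\varphi^r_{B,A})$ is a right $B$-module algebra. -/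

import Mathlib

open scoped TensorProduct

noncomputable section

namespace WMHopf

section Multipliers

variable (A : Type*) [NonUnitalRing A] [Module ℂ A] [IsScalarTower ℂ A A] [SMulCommClass ℂ A A]

/-- The multipliers `M(A)`: pairs `(l, r)` of linear maps `A → A` with `l (ab) = l(a) b`,
`r (ab) = a r(b)` and `r(a) b = a l(b)`; one writes `m a = l(a)` and `a m = r(a)`. -/
@[ext]
structure Multiplier where
  /-- `a ↦ m a` -/
  lmul : A →ₗ[ℂ] A
  /-- `a ↦ a m` -/
  rmul : A →ₗ[ℂ] A
  lmul_mul : ∀ a b, lmul (a * b) = lmul a * b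
  rmul_mul : ∀ a b, rmul (a * b) = a * rmul b
  rmul_mul_eq : ∀ a b, rmul a * b = a * lmul b

namespace Multiplier

variable {A}

instance : Zero (Multiplier A) := ⟨⟨0, 0, by simp, by simp, by simp⟩⟩

instance : Add (Multiplier A) :=
  ⟨fun m n => ⟨m.lmul + n.lmul, m.rmul + n.rmul,
    fun a b => by simp [m.lmul_mul, n.lmul_mul, add_mul],
    fun a b => by simp [m.rmul_mul, n.rmul_mul, mul_add],
    fun a b => by simp [m.rmul_mul_eq, n.rmul_mul_eq, add_mul, mul_add]⟩⟩

instance : Neg (Multiplier A) :=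
  ⟨fun m => ⟨-m.lmul, -m.rmul, fun a b => by simp [m.lmul_mul],
    fun a b => by simp [m.rmul_mul], fun a b => by simp [m.rmul_mul_eq]⟩⟩

instance : SMul ℂ (Multiplier A) :=
  ⟨fun c m => ⟨c • m.lmul, c • m.rmul, fun a b => by simp [m.lmul_mul, smul_mul_assoc],
    fun a b => by simp [m.rmul_mul, mul_smul_comm],
    fun a b => by simp [m.rmul_mul_eq, smul_mul_assoc, mul_smul_comm]⟩⟩

/-- The identity `1` of `M(A)`. -/
instance : One (Multiplier A) :=
  ⟨⟨LinearMap.id, LinearMap.id, by simp, by simp, by simp⟩⟩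

/-- The product of `M(A)`: `(m n) a = m (n a)` and `a (m n) = (a m) n`. -/
instance : Mul (Multiplier A) :=
  ⟨fun m n => ⟨m.lmul ∘ₗ n.lmul, n.rmul ∘ₗ m.rmul,
    fun a b => by simp [m.lmul_mul, n.lmul_mul],
    fun a b => by simp [m.rmul_mul, n.rmul_mul],
    fun a b => by simp [m.rmul_mul_eq, n.rmul_mul_eq]⟩⟩

instance : AddCommGroup (Multiplier A) where
  add_assoc _ _ _ := Multiplier.ext (add_assoc _ _ _) (add_assoc _ _ _)
  zero_add _ := Multiplier.ext (zero_add _) (zero_add _)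
  add_zero _ := Multiplier.ext (add_zero _) (add_zero _)
  add_comm _ _ := Multiplier.ext (add_comm _ _) (add_comm _ _)
  neg_add_cancel _ := Multiplier.ext (neg_add_cancel _) (neg_add_cancel _)
  nsmul := nsmulRec
  zsmul := zsmulRec

instance : Module ℂ (Multiplier A) where
  one_smul _ := Multiplier.ext (one_smul _ _) (one_smul _ _)
  mul_smul _ _ _ := Multiplier.ext (mul_smul _ _ _) (mul_smul _ _ _)
  smul_zero _ := Multiplier.ext (smul_zero _) (smul_zero _)
  smul_add _ _ _ := Multiplier.ext (smul_add _ _ _) (smul_add _ _ _)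
  add_smul _ _ _ := Multiplier.ext (add_smul _ _ _) (add_smul _ _ _)
  zero_smul _ := Multiplier.ext (zero_smul _ _) (zero_smul _ _)

instance : Monoid (Multiplier A) where
  mul_assoc _ _ _ := rfl
  one_mul _ := rfl
  mul_one _ := rfl

end Multiplier

variable {A}

/-- The canonical map `A → M(A)` (an embedding when the product of `A` is non-degenerate). -/
def toMul : A →ₗ[ℂ] Multiplier A where
  toFun a := ⟨LinearMap.mulLeft ℂ a, LinearMap.mulRight ℂ a,
    fun x y => by simp [mul_assoc], fun x y => by simp [mul_assoc],
    fun x y => by simp [mul_assoc]⟩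
  map_add' a b := Multiplier.ext (LinearMap.ext fun x => add_mul a b x)
    (LinearMap.ext fun x => mul_add x a b)
  map_smul' c a := Multiplier.ext (LinearMap.ext fun x => smul_mul_assoc c a x)
    (LinearMap.ext fun x => mul_smul_comm c x a)

variable {B : Type*} [NonUnitalRing B] [Module ℂ B] [IsScalarTower ℂ B B] [SMulCommClass ℂ B B]

/-- The bilinear map `M(A) × M(B) → M(A ⊗ B)`, `(m, n) ↦ m ⊗ n`, which acts factorwise. -/
def tmulMul : Multiplier A →ₗ[ℂ] Multiplier B →ₗ[ℂ] Multiplier (A ⊗[ℂ] B) :=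
  LinearMap.mk₂ ℂ
    (fun m n =>
      { lmul := TensorProduct.map m.lmul n.lmul
        rmul := TensorProduct.map m.rmul n.rmul
        lmul_mul := fun s t => by
          induction s using TensorProduct.induction_on with
          | zero => simp
          | add x y hx hy => simp only [add_mul, map_add, hx, hy]
          | tmul a b =>
            induction t using TensorProduct.induction_on with
            | zero => simp
            | add x y hx hy => simp only [mul_add, map_add, hx, hy]
            | tmul c d => simp [m.lmul_mul, n.lmul_mul]
        rmul_mul := fun s t => by
          induction s using TensorProduct.induction_on with
          | zero => simp
          | add x y hx hy => simp only [add_mul, map_add, hx, hy]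
          | tmul a b =>
            induction t using TensorProduct.induction_on with
            | zero => simp
            | add x y hx hy => simp only [mul_add, map_add, hx, hy]
            | tmul c d => simp [m.rmul_mul, n.rmul_mul]
        rmul_mul_eq := fun s t => by
          induction s using TensorProduct.induction_on with
          | zero => simp
          | add x y hx hy => simp only [add_mul, map_add, hx, hy]
          | tmul a b =>
            induction t using TensorProduct.induction_on with
            | zero => simp
            | add x y hx hy => simp only [mul_add, map_add, hx, hy]
            | tmul c d => simp [m.rmul_mul_eq, n.rmul_mul_eq] })
    (fun _ _ _ => Multiplier.ext (TensorProduct.map_add_left _ _ _)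
      (TensorProduct.map_add_left _ _ _))
    (fun _ _ _ => Multiplier.ext (TensorProduct.map_smul_left _ _ _)
      (TensorProduct.map_smul_left _ _ _))
    (fun _ _ _ => Multiplier.ext (TensorProduct.map_add_right _ _ _)
      (TensorProduct.map_add_right _ _ _))
    (fun _ _ _ => Multiplier.ext (TensorProduct.map_smul_right _ _ _)
      (TensorProduct.map_smul_right _ _ _))

/-- Transport of multipliers along a multiplicative linear isomorphism `e`:
`(conj e m) x = e (m (e⁻¹ x))` and `x (conj e m) = e ((e⁻¹ x) m)`. -/
def conj (e : A ≃ₗ[ℂ] B) (he : ∀ x y, e (x * y) = e x * e y) (m : Multiplier A) :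
    Multiplier B :=
  have he' : ∀ x y, e.symm (x * y) = e.symm x * e.symm y := fun x y => by
    apply e.injective; simp [he]
  { lmul := e.toLinearMap ∘ₗ m.lmul ∘ₗ e.symm.toLinearMap
    rmul := e.toLinearMap ∘ₗ m.rmul ∘ₗ e.symm.toLinearMap
    lmul_mul := fun x y => by simp [he', m.lmul_mul, he]
    rmul_mul := fun x y => by simp [he', m.rmul_mul, he]
    rmul_mul_eq := fun x y => by
      have := congrArg e (m.rmul_mul_eq (e.symm x) (e.symm y))
      simpa [he] using this }

variable (A) in
theorem comm_mul (x y : A ⊗[ℂ] A) :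
    TensorProduct.comm ℂ A A (x * y) = TensorProduct.comm ℂ A A x * TensorProduct.comm ℂ A A y := by
  induction x using TensorProduct.induction_on with
  | zero => simp
  | add x x' hx hx' => simp only [add_mul, map_add, hx, hx']
  | tmul a b =>
    induction y using TensorProduct.induction_on with
    | zero => simp
    | add y y' hy hy' => simp only [mul_add, map_add, hy, hy']
    | tmul c d => simp

variable (A) in
theorem assoc_mul (x y : (A ⊗[ℂ] A) ⊗[ℂ] A) :
    TensorProduct.assoc ℂ A A A (x * y) =
      TensorProduct.assoc ℂ A A A x * TensorProduct.assoc ℂ A A A y := by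
  induction x using TensorProduct.induction_on with
  | zero => simp
  | add x x' hx hx' => simp only [add_mul, map_add, hx, hx']
  | tmul s b =>
    induction y using TensorProduct.induction_on with
    | zero => simp
    | add y y' hy hy' => simp only [mul_add, map_add, hy, hy']
    | tmul t d =>
      induction s using TensorProduct.induction_on with
      | zero => simp
      | add x x' hx hx' => simp only [TensorProduct.add_tmul, add_mul, map_add, hx, hx']
      | tmul a a' =>
        induction t using TensorProduct.induction_on with
        | zero => simp
        | add x x' hx hx' => simp only [TensorProduct.add_tmul, mul_add, map_add, hx, hx']
        | tmul c c' => simp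

/-- The flip on `M(A ⊗ A)`. -/
def flipMul (m : Multiplier (A ⊗[ℂ] A)) : Multiplier (A ⊗[ℂ] A) :=
  conj (TensorProduct.comm ℂ A A) (comm_mul A) m

/-- The identification `M((A ⊗ A) ⊗ A) = M(A ⊗ (A ⊗ A))`. -/
def assocMul (m : Multiplier ((A ⊗[ℂ] A) ⊗[ℂ] A)) : Multiplier (A ⊗[ℂ] (A ⊗[ℂ] A)) :=
  conj (TensorProduct.assoc ℂ A A A) (assoc_mul A) m

/-- `Δ ⊗ ι : A ⊗ A → M(A ⊗ A ⊗ A)`. -/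
def deltaId (Δ : A →ₗ[ℂ] Multiplier (A ⊗[ℂ] A)) (t : A ⊗[ℂ] A) :
    Multiplier (A ⊗[ℂ] (A ⊗[ℂ] A)) :=
  assocMul (TensorProduct.lift
    (tmulMul.compl₁₂ Δ toMul) t)

/-- `ι ⊗ Δ : A ⊗ A → M(A ⊗ A ⊗ A)`. -/
def idDelta (Δ : A →ₗ[ℂ] Multiplier (A ⊗[ℂ] A)) (t : A ⊗[ℂ] A) :
    Multiplier (A ⊗[ℂ] (A ⊗[ℂ] A)) :=
  TensorProduct.lift
    (tmulMul.compl₁₂ toMul Δ) t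

/-- `X` is the value at `m ∈ M(A ⊗ A)` of the extension of `ι ⊗ Δ` to `M(A ⊗ A)`.  This extension
is the homomorphism with `(ι ⊗ Δ)(1) = 1 ⊗ E`; since `(ι ⊗ Δ)(A ⊗ A)` generates the
ideals `(1 ⊗ E)(A ⊗ A ⊗ A)` and `(A ⊗ A ⊗ A)(1 ⊗ E)`, at most one `X` has these properties. -/
def IsIdDeltaExt (Δ : A →ₗ[ℂ] Multiplier (A ⊗[ℂ] A)) (E m : Multiplier (A ⊗[ℂ] A))
    (X : Multiplier (A ⊗[ℂ] (A ⊗[ℂ] A))) : Prop :=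
  tmulMul 1 E * X = X ∧ X * tmulMul 1 E = X ∧
    ∀ t : A ⊗[ℂ] A, X * idDelta Δ t = idDelta Δ (m.lmul t) ∧
      idDelta Δ t * X = idDelta Δ (m.rmul t)

/-- For `T(a ⊗ c) = Δ(a)(1 ⊗ c)` this is `b ⊗ c ↦ Δ₁₃(a)(1 ⊗ b ⊗ c)`, that is
`b ⊗ c ↦ ∑ a₁ ⊗ b ⊗ a₂ c`. -/
def delta13Left (T : A ⊗[ℂ] A →ₗ[ℂ] A ⊗[ℂ] A) (a : A) : A ⊗[ℂ] A →ₗ[ℂ] (A ⊗[ℂ] A) ⊗[ℂ] A :=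
  (TensorProduct.rightComm ℂ A A A).toLinearMap ∘ₗ
    LinearMap.rTensor A (T ∘ₗ TensorProduct.mk ℂ A A a) ∘ₗ
    (TensorProduct.comm ℂ A A).toLinearMap

/-- For `T(a ⊗ c) = (a ⊗ 1)Δ(c)` this is `a ⊗ b ↦ (a ⊗ b ⊗ 1)Δ₁₃(c)`, that is
`a ⊗ b ↦ ∑ a c₁ ⊗ b ⊗ c₂`. -/
def delta13Right (T : A ⊗[ℂ] A →ₗ[ℂ] A ⊗[ℂ] A) (c : A) : A ⊗[ℂ] A →ₗ[ℂ] A ⊗[ℂ] (A ⊗[ℂ] A) :=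
  (TensorProduct.assoc ℂ A A A).toLinearMap ∘ₗ
    (TensorProduct.rightComm ℂ A A A).toLinearMap ∘ₗ
    LinearMap.rTensor A (T ∘ₗ (TensorProduct.mk ℂ A A).flip c)

/-- `f ⊗ ι : A ⊗ A → A` for a linear functional `f`. -/
def funId (f : A →ₗ[ℂ] ℂ) : A ⊗[ℂ] A →ₗ[ℂ] A :=
  (TensorProduct.lid ℂ A).toLinearMap ∘ₗ LinearMap.rTensor A f

/-- `ι ⊗ f : A ⊗ A → A` for a linear functional `f`. -/
def idFun (f : A →ₗ[ℂ] ℂ) : A ⊗[ℂ] A →ₗ[ℂ] A :=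
  (TensorProduct.rid ℂ A).toLinearMap ∘ₗ LinearMap.lTensor A f

end Multipliers

section HopfStructures

/-- A weak multiplier Hopf algebra structure on the algebra `A`.  The maps `T₁`, `T₂`, `ε`, `E`,
`G₁`, `G₂` are determined by the coproduct `Δ`. -/
structure WeakMultiplierHopf (A : Type*) [NonUnitalRing A] [Module ℂ A] [IsScalarTower ℂ A A]
    [SMulCommClass ℂ A A] where
  /-- the product is non-degenerate -/
  nondeg_left : ∀ a : A, (∀ b, a * b = 0) → a = 0
  nondeg_right : ∀ a : A, (∀ b, b * a = 0) → a = 0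
  /-- the algebra is idempotent, `A² = A` -/
  idem : Function.Surjective (LinearMap.mul' ℂ A)
  /-- the coproduct, a homomorphism -/
  Δ : A →ₗ[ℂ] Multiplier (A ⊗[ℂ] A)
  Δ_mul : ∀ a b, Δ (a * b) = Δ a * Δ b
  /-- the canonical map `T₁(a ⊗ b) = Δ(a)(1 ⊗ b)` -/
  T₁ : A ⊗[ℂ] A →ₗ[ℂ] A ⊗[ℂ] A
  T₁_spec : ∀ a b, toMul (T₁ (a ⊗ₜ b)) = Δ a * tmulMul 1 (toMul b)
  /-- the canonical map `T₂(a ⊗ b) = (a ⊗ 1)Δ(b)` -/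
  T₂ : A ⊗[ℂ] A →ₗ[ℂ] A ⊗[ℂ] A
  T₂_spec : ∀ a b, toMul (T₂ (a ⊗ₜ b)) = tmulMul (toMul a) 1 * Δ b
  /-- coassociativity:
  `(c ⊗ 1 ⊗ 1)(Δ ⊗ ι)(Δ(a)(1 ⊗ b)) = (ι ⊗ Δ)((c ⊗ 1)Δ(a))(1 ⊗ 1 ⊗ b)` -/
  coassoc : ∀ a b c,
    tmulMul (toMul c) 1 * deltaId Δ (T₁ (a ⊗ₜ b)) =
      idDelta Δ (T₂ (c ⊗ₜ a)) * tmulMul 1 (tmulMul 1 (toMul b))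
  /-- the coproduct is full -/
  full_left : ∀ V : Submodule ℂ A,
    (∀ t, T₁ t ∈ LinearMap.range (LinearMap.rTensor A V.subtype)) → V = ⊤
  full_right : ∀ W : Submodule ℂ A,
    (∀ t, T₂ t ∈ LinearMap.range (LinearMap.lTensor A W.subtype)) → W = ⊤
  /-- the counit -/
  ε : A →ₗ[ℂ] ℂ
  counit_left : ∀ a b, funId ε (T₁ (a ⊗ₜ b)) = a * b
  counit_right : ∀ a b, idFun ε (T₂ (a ⊗ₜ b)) = a * b
  /-- the canonical idempotent -/
  E : Multiplier (A ⊗[ℂ] A)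
  E_idem : E * E = E
  range_T₁ : LinearMap.range T₁ = LinearMap.range E.lmul
  range_T₂ : LinearMap.range T₂ = LinearMap.range E.rmul
  /-- `(ι ⊗ Δ)E = (E ⊗ 1)(1 ⊗ E) = (1 ⊗ E)(E ⊗ 1)` -/
  idDelta_E : IsIdDeltaExt Δ E E (assocMul (tmulMul E 1) * tmulMul 1 E)
  E_comm : assocMul (tmulMul E 1) * tmulMul 1 E = tmulMul 1 E * assocMul (tmulMul E 1)
  /-- `(G₁ ⊗ ι)(Δ₁₃(a)(1 ⊗ b ⊗ c)) = Δ₁₃(a)(1 ⊗ E)(1 ⊗ b ⊗ c)` -/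
  G₁ : A ⊗[ℂ] A →ₗ[ℂ] A ⊗[ℂ] A
  G₁_spec : ∀ a b c, LinearMap.rTensor A G₁ (delta13Left T₁ a (b ⊗ₜ c)) =
    delta13Left T₁ a (E.lmul (b ⊗ₜ c))
  ker_T₁ : LinearMap.ker T₁ = LinearMap.range (LinearMap.id - G₁)
  /-- `(ι ⊗ G₂)((a ⊗ b ⊗ 1)Δ₁₃(c)) = (a ⊗ b ⊗ 1)(E ⊗ 1)Δ₁₃(c)` -/
  G₂ : A ⊗[ℂ] A →ₗ[ℂ] A ⊗[ℂ] A
  G₂_spec : ∀ a b c, LinearMap.lTensor A G₂ (delta13Right T₂ c (a ⊗ₜ b)) =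
    delta13Right T₂ c (E.rmul (a ⊗ₜ b))
  ker_T₂ : LinearMap.ker T₂ = LinearMap.range (LinearMap.id - G₂)

/-- A regular weak multiplier Hopf algebra: the coproduct is regular and `(A, Δ^cop)` is a weak
multiplier Hopf algebra as well. -/
structure RegularWeakMultiplierHopf (A : Type*) [NonUnitalRing A] [Module ℂ A]
    [IsScalarTower ℂ A A] [SMulCommClass ℂ A A] extends WeakMultiplierHopf A where
  /-- `T₃(a ⊗ b) = (1 ⊗ b)Δ(a)` -/
  T₃ : A ⊗[ℂ] A →ₗ[ℂ] A ⊗[ℂ] A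
  T₃_spec : ∀ a b, toMul (T₃ (a ⊗ₜ b)) = tmulMul 1 (toMul b) * Δ a
  /-- `T₄(a ⊗ b) = Δ(b)(a ⊗ 1)` -/
  T₄ : A ⊗[ℂ] A →ₗ[ℂ] A ⊗[ℂ] A
  T₄_spec : ∀ a b, toMul (T₄ (a ⊗ₜ b)) = Δ b * tmulMul (toMul a) 1
  /-- the weak multiplier Hopf algebra `(A, Δ^cop)` -/
  cop : WeakMultiplierHopf A
  cop_Δ : ∀ a, cop.Δ a = flipMul (Δ a)

end HopfStructures

section ModuleAlgebras

variable {C V : Type*} [NonUnitalRing C] [Module ℂ C] [IsScalarTower ℂ C C]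
  [SMulCommClass ℂ C C] [AddCommGroup V] [Module ℂ V]

/-- For a unital left `C`-module `V`, the extended action of `m ∈ M(C)` sends `v` to `v'`:
`v = ∑ cᵢ vᵢ` and `v' = ∑ (m cᵢ) vᵢ`. -/
def LeftMulActs (act : C →ₗ[ℂ] V →ₗ[ℂ] V) (m : Multiplier C) (v v' : V) : Prop :=
  ∃ w : C ⊗[ℂ] V, TensorProduct.lift act w = v ∧
    TensorProduct.lift act (LinearMap.rTensor V m.lmul w) = v'

/-- For a unital right `C`-module `V`, the extended action of `m ∈ M(C)` sends `v` to `v'`: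
`v = ∑ vᵢ cᵢ` and `v' = ∑ vᵢ (cᵢ m)`. -/
def RightMulActs (act : V →ₗ[ℂ] C →ₗ[ℂ] V) (m : Multiplier C) (v v' : V) : Prop :=
  ∃ w : V ⊗[ℂ] C, TensorProduct.lift act w = v ∧
    TensorProduct.lift act (LinearMap.lTensor V m.rmul w) = v'

variable {A R : Type*} [NonUnitalRing A] [Module ℂ A] [IsScalarTower ℂ A A]
  [SMulCommClass ℂ A A] [NonUnitalRing R] [Module ℂ R] [IsScalarTower ℂ R R]
  [SMulCommClass ℂ R R]

/-- `act` (written `a ▷ x`) makes the algebra `R` a left `A`-module algebra: `R` is a unital left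
`A`-module and `a ▷ (xy) = mul (Δ(a) ▷ (x ⊗ y)) = ∑ (a₁ ▷ x)(a₂ ▷ y)`, where `M(A ⊗ A)` acts on
`R ⊗ R` by extension of the factorwise action of `A ⊗ A`. -/
structure IsLeftModuleAlgebra (H : WeakMultiplierHopf A) (act : A →ₗ[ℂ] R →ₗ[ℂ] R) : Prop where
  mul_act : ∀ a b x, act (a * b) x = act a (act b x)
  unital : Function.Surjective (TensorProduct.lift act)
  act_mul : ∀ a x y s, LeftMulActs (TensorProduct.map₂ act act) (H.Δ a) (x ⊗ₜ[ℂ] y) s →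
    act a (x * y) = LinearMap.mul' ℂ R s

/-- `act` (written `x ◁ a`) makes the algebra `R` a right `A`-module algebra: `R` is a unital right
`A`-module and `(xy) ◁ a = mul ((x ⊗ y) ◁ Δ(a)) = ∑ (x ◁ a₁)(y ◁ a₂)`. -/
structure IsRightModuleAlgebra (H : WeakMultiplierHopf A) (act : R →ₗ[ℂ] A →ₗ[ℂ] R) : Prop where
  act_mul : ∀ a b x, act x (a * b) = act (act x a) b
  unital : Function.Surjective (TensorProduct.lift act)
  mul_act : ∀ a x y s, RightMulActs (TensorProduct.map₂ act act) (H.Δ a) (x ⊗ₜ[ℂ] y) s →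
    act (x * y) a = LinearMap.mul' ℂ R s

end ModuleAlgebras

section Pairings

theorem funId_add {A : Type*} [NonUnitalRing A] [Module ℂ A] (f g : A →ₗ[ℂ] ℂ) (t : A ⊗[ℂ] A) :
    funId (f + g) t = funId f t + funId g t := by
  simp [funId, LinearMap.rTensor_add]

theorem funId_smul {A : Type*} [NonUnitalRing A] [Module ℂ A] (k : ℂ) (f : A →ₗ[ℂ] ℂ) (t : A ⊗[ℂ] A) :
    funId (k • f) t = k • funId f t := by
  simp [funId, LinearMap.rTensor_smul]

theorem idFun_add {A : Type*} [NonUnitalRing A] [Module ℂ A] (f g : A →ₗ[ℂ] ℂ) (t : A ⊗[ℂ] A) :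
    idFun (f + g) t = idFun f t + idFun g t := by
  simp [idFun, LinearMap.lTensor_add]

theorem idFun_smul {A : Type*} [NonUnitalRing A] [Module ℂ A] (k : ℂ) (f : A →ₗ[ℂ] ℂ) (t : A ⊗[ℂ] A) :
    idFun (k • f) t = k • idFun f t := by
  simp [idFun, LinearMap.lTensor_smul]

variable {A B : Type*} [NonUnitalRing A] [Module ℂ A] [IsScalarTower ℂ A A] [SMulCommClass ℂ A A]
  [NonUnitalRing B] [Module ℂ B] [IsScalarTower ℂ B B] [SMulCommClass ℂ B B]

/-- The multiplier `(f ⊗ ι)Δ(a)` of `A` is the element `z` of `A`: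
`z c = (f ⊗ ι)(Δ(a)(1 ⊗ c))` and `c z = (f ⊗ ι)((1 ⊗ c)Δ(a))`. -/
def RegularWeakMultiplierHopf.IsFunId (H : RegularWeakMultiplierHopf A) (f : A →ₗ[ℂ] ℂ)
    (a z : A) : Prop :=
  ∀ c, z * c = funId f (H.T₁ (a ⊗ₜ c)) ∧ c * z = funId f (H.T₃ (a ⊗ₜ c))

/-- The multiplier `(ι ⊗ f)Δ(a)` of `A` is the element `z` of `A`:
`z c = (ι ⊗ f)(Δ(a)(c ⊗ 1))` and `c z = (ι ⊗ f)((c ⊗ 1)Δ(a))`. -/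
def RegularWeakMultiplierHopf.IsIdFun (H : RegularWeakMultiplierHopf A) (f : A →ₗ[ℂ] ℂ)
    (a z : A) : Prop :=
  ∀ c, z * c = idFun f (H.T₄ (c ⊗ₜ a)) ∧ c * z = idFun f (H.T₂ (c ⊗ₜ a))

theorem eq_of_mul_right (H : RegularWeakMultiplierHopf A) {z w : A} (h : ∀ c, z * c = w * c) :
    z = w :=
  sub_eq_zero.1 (H.nondeg_left _ fun c => by rw [sub_mul, h, sub_self])

/-- If all the multipliers `(F x ⊗ ι)Δ(a)` lie in `A`, this is the bilinear map sending `(x, a)` to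
that element. -/
def funIdMap (H : RegularWeakMultiplierHopf A) {X : Type*} [AddCommGroup X] [Module ℂ X]
    (F : X →ₗ[ℂ] A →ₗ[ℂ] ℂ) (h : ∀ x a, ∃ z, H.IsFunId (F x) a z) : X →ₗ[ℂ] A →ₗ[ℂ] A :=
  LinearMap.mk₂ ℂ (fun x a => (h x a).choose)
    (fun x x' a => eq_of_mul_right H fun c => by
      rw [add_mul, ((h _ _).choose_spec c).1, ((h _ _).choose_spec c).1,
        ((h _ _).choose_spec c).1, map_add, funId_add])
    (fun k x a => eq_of_mul_right H fun c => by
      rw [smul_mul_assoc, ((h _ _).choose_spec c).1, ((h _ _).choose_spec c).1, map_smul,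
        funId_smul])
    (fun x a a' => eq_of_mul_right H fun c => by
      rw [add_mul, ((h _ _).choose_spec c).1, ((h _ _).choose_spec c).1,
        ((h _ _).choose_spec c).1, TensorProduct.add_tmul, map_add, map_add])
    (fun k x a => eq_of_mul_right H fun c => by
      rw [smul_mul_assoc, ((h _ _).choose_spec c).1, ((h _ _).choose_spec c).1,
        ← TensorProduct.smul_tmul', map_smul, map_smul])

/-- If all the multipliers `(ι ⊗ F x)Δ(a)` lie in `A`, this is the bilinear map sending `(x, a)` to
that element. -/
def idFunMap (H : RegularWeakMultiplierHopf A) {X : Type*} [AddCommGroup X] [Module ℂ X]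
    (F : X →ₗ[ℂ] A →ₗ[ℂ] ℂ) (h : ∀ x a, ∃ z, H.IsIdFun (F x) a z) : X →ₗ[ℂ] A →ₗ[ℂ] A :=
  LinearMap.mk₂ ℂ (fun x a => (h x a).choose)
    (fun x x' a => eq_of_mul_right H fun c => by
      rw [add_mul, ((h _ _).choose_spec c).1, ((h _ _).choose_spec c).1,
        ((h _ _).choose_spec c).1, map_add, idFun_add])
    (fun k x a => eq_of_mul_right H fun c => by
      rw [smul_mul_assoc, ((h _ _).choose_spec c).1, ((h _ _).choose_spec c).1, map_smul,
        idFun_smul])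
    (fun x a a' => eq_of_mul_right H fun c => by
      rw [add_mul, ((h _ _).choose_spec c).1, ((h _ _).choose_spec c).1,
        ((h _ _).choose_spec c).1, TensorProduct.tmul_add, map_add, map_add])
    (fun k x a => eq_of_mul_right H fun c => by
      rw [smul_mul_assoc, ((h _ _).choose_spec c).1, ((h _ _).choose_spec c).1,
        TensorProduct.tmul_smul, map_smul, map_smul])

/-- A bilinear form on `A × B` all of whose slices of the coproducts are elements of the algebras:
`(⟨a, ·⟩ ⊗ ι)Δ(b)`, `(ι ⊗ ⟨a, ·⟩)Δ(b)` lie in `B` and `(⟨·, b⟩ ⊗ ι)Δ(a)`, `(ι ⊗ ⟨·, b⟩)Δ(a)` lie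
in `A`. -/
structure SliceForm (HA : RegularWeakMultiplierHopf A) (HB : RegularWeakMultiplierHopf B) where
  /-- `form a b = ⟨a, b⟩` -/
  form : A →ₗ[ℂ] B →ₗ[ℂ] ℂ
  funId_B : ∀ a b, ∃ z, HB.IsFunId (form a) b z
  idFun_B : ∀ a b, ∃ z, HB.IsIdFun (form a) b z
  funId_A : ∀ b a, ∃ z, HA.IsFunId (form.flip b) a z
  idFun_A : ∀ b a, ∃ z, HA.IsIdFun (form.flip b) a z

variable {HA : RegularWeakMultiplierHopf A} {HB : RegularWeakMultiplierHopf B}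

/-- `φˡ_{A,B} : a ⊗ b ↦ a ▷ b = (ι ⊗ ⟨a, ·⟩)Δ(b) = ∑ ⟨a, b₂⟩ b₁`. -/
def SliceForm.leftAB (P : SliceForm HA HB) : A →ₗ[ℂ] B →ₗ[ℂ] B :=
  idFunMap HB P.form P.idFun_B

/-- `φʳ_{A,B} : b ⊗ a ↦ b ◁ a = (⟨a, ·⟩ ⊗ ι)Δ(b) = ∑ ⟨a, b₁⟩ b₂`. -/
def SliceForm.rightAB (P : SliceForm HA HB) : B →ₗ[ℂ] A →ₗ[ℂ] B :=
  (funIdMap HB P.form P.funId_B).flip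

/-- `φˡ_{B,A} : b ⊗ a ↦ b ▷ a = (ι ⊗ ⟨·, b⟩)Δ(a) = ∑ a₁ ⟨a₂, b⟩`. -/
def SliceForm.leftBA (P : SliceForm HA HB) : B →ₗ[ℂ] A →ₗ[ℂ] A :=
  idFunMap HA P.form.flip P.idFun_A

/-- `φʳ_{B,A} : a ⊗ b ↦ a ◁ b = (⟨·, b⟩ ⊗ ι)Δ(a) = ∑ a₂ ⟨a₁, b⟩`. -/
def SliceForm.rightBA (P : SliceForm HA HB) : A →ₗ[ℂ] B →ₗ[ℂ] A :=
  (funIdMap HA P.form.flip P.funId_A).flip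

/-- A pre-pairing of two regular weak multiplier Hopf algebras. -/
structure PrePairing (HA : RegularWeakMultiplierHopf A) (HB : RegularWeakMultiplierHopf B)
    extends SliceForm HA HB where
  form_leftAB : ∀ a a' b, form a (toSliceForm.leftAB a' b) = form (a * a') b
  form_rightAB : ∀ a a' b, form a' (toSliceForm.rightAB b a) = form (a * a') b
  form_leftBA : ∀ a b b', form (toSliceForm.leftBA b' a) b = form a (b * b')
  form_rightBA : ∀ a b b', form (toSliceForm.rightBA a b) b' = form a (b * b')

/-- A pairing: the four maps are surjective, and `ε_A(a) = ⟨a, 1⟩`, `ε_B(b) = ⟨1, b⟩`.  The numbers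
`⟨a, 1⟩` and `⟨1, b⟩` come from the extension of the pairing to multipliers, so they are given by
`⟨b ▷ a, 1⟩ = ⟨a, b⟩ = ⟨a ◁ b, 1⟩` and `⟨1, a ▷ b⟩ = ⟨a, b⟩ = ⟨1, b ◁ a⟩`. -/
structure Pairing (HA : RegularWeakMultiplierHopf A) (HB : RegularWeakMultiplierHopf B)
    extends PrePairing HA HB where
  surj_leftAB : Function.Surjective (TensorProduct.lift toSliceForm.leftAB)
  surj_rightAB : Function.Surjective (TensorProduct.lift toSliceForm.rightAB)
  surj_leftBA : Function.Surjective (TensorProduct.lift toSliceForm.leftBA)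
  surj_rightBA : Function.Surjective (TensorProduct.lift toSliceForm.rightBA)
  counit_leftBA : ∀ a b, HA.ε (toSliceForm.leftBA b a) = form a b
  counit_rightBA : ∀ a b, HA.ε (toSliceForm.rightBA a b) = form a b
  counit_leftAB : ∀ a b, HB.ε (toSliceForm.leftAB a b) = form a b
  counit_rightAB : ∀ a b, HB.ε (toSliceForm.rightAB b a) = form a b

end Pairings

end WMHopf

end

/-!
For `a = b' ▷ a'` the map `b ↦ a ▷ b` is the slice `b ↦ (ι ⊗ ⟨a', ·⟩)(Δ(b)(1 ⊗ b'))`, and such `a`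
span `A`. Slicing coassociativity therefore gives `(c ⊗ 1)Δ(a ▷ b) = (ι ⊗ a ▷)((c ⊗ 1)Δ(b))`, from
which `aa' ▷ b = a ▷ (a' ▷ b)` follows by pairing the second leg with an element of `A`.

For the module algebra property, fix `e ∈ B` and let `K = (e ⊗ 1 ⊗ 1)Δ₁₂(c)Δ₁₃(d)`, an element of
`B ⊗ B ⊗ B`. Since `Δ` is multiplicative, `e (a ▷ ((p ▷ c)(q ▷ d)))` is obtained from `K` by
applying `g ⊗ h ↦ ⟨a, (p ▷ g)(q ▷ h)⟩` to the last two legs, while `e` times the product of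
`Δ(a)(p ⊗ q) ▷ (c ⊗ d)` is obtained by applying `⟨Δ(a)(p ⊗ q), ·⟩`. The two functionals agree by the
axioms of a pairing, and `e` can be cancelled although the pairing itself may be degenerate.

For the right actions `K` is replaced by `Δ₁₃(c)Δ₂₃(d)(1 ⊗ 1 ⊗ e)`.
-/

noncomputable section

namespace WMHopf

section TensorProducts

variable {R M N V W ι : Type*} [CommRing R] [AddCommGroup M] [Module R M] [AddCommGroup N]
  [Module R N] [AddCommGroup V] [Module R V] [AddCommGroup W] [Module R W]

theorem rid_lTensor_rTensor (φ : V →ₗ[R] R) (f : M →ₗ[R] N) (t : M ⊗[R] V) :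
    TensorProduct.rid R N (φ.lTensor N (f.rTensor V t)) =
      f (TensorProduct.rid R M (φ.lTensor M t)) := by
  induction t using TensorProduct.induction_on with
  | zero => simp
  | add x y hx hy => simp only [map_add, hx, hy]
  | tmul x y => simp

theorem lid_rTensor_lTensor (φ : V →ₗ[R] R) (f : M →ₗ[R] N) (t : V ⊗[R] M) :
    TensorProduct.lid R N (φ.rTensor N (f.lTensor V t)) =
      f (TensorProduct.lid R M (φ.rTensor M t)) := by
  induction t using TensorProduct.induction_on with
  | zero => simp
  | add x y hx hy => simp only [map_add, hx, hy]
  | tmul x y => simp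

theorem eq_zero_of_forall_rTensor_eq_zero [Module.Free R V] (f : ι → M →ₗ[R] N)
    (hf : ∀ x, (∀ i, f i x = 0) → x = 0) (t : M ⊗[R] V) (ht : ∀ i, (f i).rTensor V t = 0) :
    t = 0 := by
  classical
  refine (TensorProduct.equivFinsuppOfBasisRight
    (Module.Free.chooseBasis R V)).map_eq_zero_iff.1 (Finsupp.ext fun k => hf _ fun i => ?_)
  rw [TensorProduct.equivFinsuppOfBasisRight_apply, ← rid_lTensor_rTensor, ht, map_zero, map_zero]

theorem eq_zero_of_forall_lTensor_eq_zero [Module.Free R V] (f : ι → M →ₗ[R] N)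
    (hf : ∀ x, (∀ i, f i x = 0) → x = 0) (t : V ⊗[R] M) (ht : ∀ i, (f i).lTensor V t = 0) :
    t = 0 := by
  classical
  refine (TensorProduct.equivFinsuppOfBasisLeft
    (Module.Free.chooseBasis R V)).map_eq_zero_iff.1 (Finsupp.ext fun k => hf _ fun i => ?_)
  rw [TensorProduct.equivFinsuppOfBasisLeft_apply, ← lid_rTensor_lTensor, ht, map_zero, map_zero]

theorem tensorProduct_eq_zero_of_forall_mul_eq_zero {A B : Type*}
    [NonUnitalRing A] [Module R A] [IsScalarTower R A A] [SMulCommClass R A A] [Module.Free R A]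
    [NonUnitalRing B] [Module R B] [IsScalarTower R B B] [SMulCommClass R B B] [Module.Free R B]
    (hA : ∀ a : A, (∀ x, a * x = 0) → a = 0) (hB : ∀ b : B, (∀ y, b * y = 0) → b = 0)
    (t : A ⊗[R] B) (ht : ∀ s, t * s = 0) : t = 0 := by
  refine eq_zero_of_forall_rTensor_eq_zero (LinearMap.mulRight R) hA t fun x => ?_
  refine eq_zero_of_forall_lTensor_eq_zero (LinearMap.mulRight R) hB _ fun y => ?_
  have mul_tmul : LinearMap.lTensor A (LinearMap.mulRight R y) ∘ₗ
      LinearMap.rTensor B (LinearMap.mulRight R x) = LinearMap.mulRight R (x ⊗ₜ[R] y) :=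
    TensorProduct.ext' fun _ _ => by simp
  exact (LinearMap.congr_fun mul_tmul t).trans (ht _)

end TensorProducts

section MultiplierRing

variable {A B : Type*} [NonUnitalRing A] [Module ℂ A] [NonUnitalRing B] [Module ℂ B]

instance : Ring (Multiplier A) where
  __ := (inferInstance : AddCommGroup (Multiplier A))
  __ := (inferInstance : Monoid (Multiplier A))
  left_distrib m _ _ := Multiplier.ext (LinearMap.ext fun _ => map_add m.lmul _ _) rfl
  right_distrib _ _ m := Multiplier.ext rfl (LinearMap.ext fun _ => map_add m.rmul _ _)
  zero_mul m := Multiplier.ext rfl (LinearMap.ext fun _ => map_zero m.rmul)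
  mul_zero m := Multiplier.ext (LinearMap.ext fun _ => map_zero m.lmul) rfl

/-- The transport of multipliers `conj` along a multiplicative linear isomorphism, as a ring
homomorphism. -/
def conjRingHom (e : A ≃ₗ[ℂ] B) (he : ∀ x y, e (x * y) = e x * e y) :
    Multiplier A →+* Multiplier B where
  toFun := conj e he
  map_zero' :=
    Multiplier.ext (LinearMap.ext fun _ => map_zero e) (LinearMap.ext fun _ => map_zero e)
  map_one' := Multiplier.ext (LinearMap.ext e.apply_symm_apply) (LinearMap.ext e.apply_symm_apply)
  map_add' _ _ :=
    Multiplier.ext (LinearMap.ext fun _ => map_add e _ _) (LinearMap.ext fun _ => map_add e _ _)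
  map_mul' m n := by
    refine Multiplier.ext (LinearMap.ext fun x => ?_) (LinearMap.ext fun x => ?_)
    · exact congrArg (e ∘ m.lmul) (e.symm_apply_apply (n.lmul (e.symm x))).symm
    · exact congrArg (e ∘ n.rmul) (e.symm_apply_apply (m.rmul (e.symm x))).symm

end MultiplierRing

section MultiplierEmbedding

variable {A B : Type*} [NonUnitalRing A] [Module ℂ A] [IsScalarTower ℂ A A] [SMulCommClass ℂ A A]
  [NonUnitalRing B] [Module ℂ B] [IsScalarTower ℂ B B] [SMulCommClass ℂ B B]

theorem toMul_injective (hA : ∀ a : A, (∀ x, a * x = 0) → a = 0) :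
    Function.Injective (toMul : A →ₗ[ℂ] Multiplier A) :=
  (injective_iff_map_eq_zero _).2 fun a ha =>
    hA a (LinearMap.congr_fun (congrArg Multiplier.lmul ha))

theorem toMul_lmul (m : Multiplier A) (a : A) : toMul (m.lmul a) = m * toMul a :=
  Multiplier.ext (LinearMap.ext fun x => (m.lmul_mul a x).symm)
    (LinearMap.ext fun x => (m.rmul_mul_eq x a).symm)

theorem toMul_rmul (m : Multiplier A) (a : A) : toMul (m.rmul a) = toMul a * m :=
  Multiplier.ext (LinearMap.ext fun x => m.rmul_mul_eq a x)
    (LinearMap.ext fun x => (m.rmul_mul x a).symm)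

theorem conjRingHom_toMul (e : A ≃ₗ[ℂ] B) (he : ∀ x y, e (x * y) = e x * e y) (a : A) :
    conjRingHom e he (toMul a) = toMul (e a) := by
  refine Multiplier.ext (LinearMap.ext fun x => ?_) (LinearMap.ext fun x => ?_)
  · exact (he a (e.symm x)).trans (by rw [e.apply_symm_apply]; rfl)
  · exact (he (e.symm x) a).trans (by rw [e.apply_symm_apply]; rfl)

theorem tmulMul_mul_tmulMul (m m' : Multiplier A) (n n' : Multiplier B) :
    tmulMul m n * tmulMul m' n' = tmulMul (m * m') (n * n') :=
  (Multiplier.ext (TensorProduct.map_comp _ _ _ _) (TensorProduct.map_comp _ _ _ _)).symm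

theorem tmulMul_one_one : tmulMul (1 : Multiplier A) (1 : Multiplier B) = 1 :=
  Multiplier.ext TensorProduct.map_id TensorProduct.map_id

theorem toMul_tmul (a : A) (b : B) : toMul (a ⊗ₜ[ℂ] b) = tmulMul (toMul a) (toMul b) :=
  Multiplier.ext (TensorProduct.ext' fun x y => Algebra.TensorProduct.tmul_mul_tmul a x b y)
    (TensorProduct.ext' fun x y => Algebra.TensorProduct.tmul_mul_tmul x a y b)

theorem assocMul_tmulMul (m n k : Multiplier A) :
    assocMul (tmulMul (tmulMul m n) k) = tmulMul m (tmulMul n k) :=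
  Multiplier.ext (TensorProduct.ext_threefold' fun _ _ _ => rfl)
    (TensorProduct.ext_threefold' fun _ _ _ => rfl)

theorem toMul_rTensor_mulLeft (a : A) (t : A ⊗[ℂ] B) :
    toMul (LinearMap.rTensor B (LinearMap.mulLeft ℂ a) t) = tmulMul (toMul a) 1 * toMul t :=
  toMul_lmul (tmulMul (toMul a) 1) t

theorem toMul_rTensor_mulRight (a : A) (t : A ⊗[ℂ] B) :
    toMul (LinearMap.rTensor B (LinearMap.mulRight ℂ a) t) = toMul t * tmulMul (toMul a) 1 :=
  toMul_rmul (tmulMul (toMul a) 1) t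

theorem toMul_lTensor_mulLeft (b : B) (t : A ⊗[ℂ] B) :
    toMul (LinearMap.lTensor A (LinearMap.mulLeft ℂ b) t) = tmulMul 1 (toMul b) * toMul t :=
  toMul_lmul (tmulMul 1 (toMul b)) t

theorem toMul_lTensor_mulRight (b : B) (t : A ⊗[ℂ] B) :
    toMul (LinearMap.lTensor A (LinearMap.mulRight ℂ b) t) = toMul t * tmulMul 1 (toMul b) :=
  toMul_rmul (tmulMul 1 (toMul b)) t

end MultiplierEmbedding

section Slices

variable {A : Type*} [NonUnitalRing A] [Module ℂ A]

theorem funId_tmul (f : A →ₗ[ℂ] ℂ) (a b : A) : funId f (a ⊗ₜ b) = f a • b := rfl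

theorem idFun_tmul (f : A →ₗ[ℂ] ℂ) (a b : A) : idFun f (a ⊗ₜ b) = f b • a := rfl

theorem funId_comp (f : A →ₗ[ℂ] ℂ) (h : A →ₗ[ℂ] A) (t : A ⊗[ℂ] A) :
    funId (f ∘ₗ h) t = funId f (h.rTensor A t) :=
  congrArg (TensorProduct.lid ℂ A) (LinearMap.rTensor_comp_apply A f h t)

theorem idFun_comp (f : A →ₗ[ℂ] ℂ) (h : A →ₗ[ℂ] A) (t : A ⊗[ℂ] A) :
    idFun (f ∘ₗ h) t = idFun f (h.lTensor A t) :=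
  congrArg (TensorProduct.rid ℂ A) (LinearMap.lTensor_comp_apply A f h t)

theorem lTensor_idFun_assoc_rTensor (f : A →ₗ[ℂ] ℂ) (g : A →ₗ[ℂ] A ⊗[ℂ] A) (t : A ⊗[ℂ] A) :
    (idFun f).lTensor A (TensorProduct.assoc ℂ A A A (g.rTensor A t)) = g (idFun f t) := by
  have assoc_tmul (s : A ⊗[ℂ] A) (z : A) :
      (idFun f).lTensor A (TensorProduct.assoc ℂ A A A (s ⊗ₜ z)) = f z • s := by
    induction s using TensorProduct.induction_on with
    | zero => simp
    | add s s' hs hs' => simp only [map_add, TensorProduct.add_tmul, smul_add, hs, hs']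
    | tmul x y => simp [idFun_tmul]
  induction t using TensorProduct.induction_on with
  | zero => simp
  | add x y hx hy => simp only [map_add, hx, hy]
  | tmul x y => rw [LinearMap.rTensor_tmul, assoc_tmul, idFun_tmul, map_smul]

theorem rTensor_funId_assoc_symm_lTensor (f : A →ₗ[ℂ] ℂ) (g : A →ₗ[ℂ] A ⊗[ℂ] A)
    (t : A ⊗[ℂ] A) :
    (funId f).rTensor A ((TensorProduct.assoc ℂ A A A).symm (g.lTensor A t)) = g (funId f t) := by
  have assoc_symm_tmul (x : A) (s : A ⊗[ℂ] A) :
      (funId f).rTensor A ((TensorProduct.assoc ℂ A A A).symm (x ⊗ₜ s)) = f x • s := by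
    induction s using TensorProduct.induction_on with
    | zero => simp
    | add s s' hs hs' => simp only [map_add, TensorProduct.tmul_add, smul_add, hs, hs']
    | tmul y z => simp [funId_tmul, TensorProduct.smul_tmul']
  induction t using TensorProduct.induction_on with
  | zero => simp
  | add x y hx hy => simp only [map_add, hx, hy]
  | tmul x y => rw [LinearMap.lTensor_tmul, assoc_symm_tmul, funId_tmul, map_smul]

end Slices

section Delta13

variable {A : Type*} [NonUnitalRing A] [Module ℂ A] (T : A ⊗[ℂ] A →ₗ[ℂ] A ⊗[ℂ] A)

theorem delta13Left_tmul (a b c : A) :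
    delta13Left T a (b ⊗ₜ c) = ((TensorProduct.mk ℂ A A).flip b).rTensor A (T (a ⊗ₜ c)) := by
  change TensorProduct.rightComm ℂ A A A (T (a ⊗ₜ c) ⊗ₜ b) = _
  induction T (a ⊗ₜ c) using TensorProduct.induction_on with
  | zero => simp
  | add x y hx hy => simp only [map_add, TensorProduct.add_tmul, hx, hy]
  | tmul x y => simp

theorem delta13Right_tmul (a b c : A) :
    delta13Right T c (a ⊗ₜ b) = (TensorProduct.mk ℂ A A b).lTensor A (T (a ⊗ₜ c)) := by
  change TensorProduct.assoc ℂ A A A (TensorProduct.rightComm ℂ A A A (T (a ⊗ₜ c) ⊗ₜ b)) = _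
  induction T (a ⊗ₜ c) using TensorProduct.induction_on with
  | zero => simp
  | add x y hx hy => simp only [map_add, TensorProduct.add_tmul, hx, hy]
  | tmul x y => simp

variable {T}

theorem delta13Left_rTensor {φ : A →ₗ[ℂ] A} (ψ : A →ₗ[ℂ] A) {a : A}
    (hφ : ∀ c, T (φ a ⊗ₜ c) = φ.rTensor A (T (a ⊗ₜ c))) (t : A ⊗[ℂ] A) :
    delta13Left T (φ a) (ψ.rTensor A t) =
      (TensorProduct.map φ ψ).rTensor A (delta13Left T a t) := by
  induction t using TensorProduct.induction_on with
  | zero => simp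
  | add x y hx hy => simp only [map_add, hx, hy]
  | tmul b c =>
    rw [LinearMap.rTensor_tmul, delta13Left_tmul, delta13Left_tmul, hφ,
      ← LinearMap.rTensor_comp_apply, ← LinearMap.rTensor_comp_apply]
    rfl

theorem delta13Right_lTensor {φ : A →ₗ[ℂ] A} (ψ : A →ₗ[ℂ] A) {c : A}
    (hφ : ∀ a, T (a ⊗ₜ φ c) = φ.lTensor A (T (a ⊗ₜ c))) (t : A ⊗[ℂ] A) :
    delta13Right T (φ c) (ψ.lTensor A t) =
      (TensorProduct.map ψ φ).lTensor A (delta13Right T c t) := by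
  induction t using TensorProduct.induction_on with
  | zero => simp
  | add x y hx hy => simp only [map_add, hx, hy]
  | tmul a b =>
    rw [LinearMap.lTensor_tmul, delta13Right_tmul, delta13Right_tmul, hφ,
      ← LinearMap.lTensor_comp_apply, ← LinearMap.lTensor_comp_apply]
    rfl

end Delta13

namespace WeakMultiplierHopf

variable {A : Type*} [NonUnitalRing A] [Module ℂ A] [IsScalarTower ℂ A A] [SMulCommClass ℂ A A]
  (H : WeakMultiplierHopf A)

include H

theorem eq_of_mul_left {z w : A} (h : ∀ c, c * z = c * w) : z = w :=
  sub_eq_zero.1 (H.nondeg_right _ fun c => by rw [mul_sub, h, sub_self])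

theorem toMul_tensor_injective : Function.Injective (toMul (A := A ⊗[ℂ] A)) :=
  toMul_injective (tensorProduct_eq_zero_of_forall_mul_eq_zero H.nondeg_left H.nondeg_left)

theorem toMul_tensor₃_injective : Function.Injective (toMul (A := A ⊗[ℂ] (A ⊗[ℂ] A))) :=
  toMul_injective (tensorProduct_eq_zero_of_forall_mul_eq_zero H.nondeg_left
    (tensorProduct_eq_zero_of_forall_mul_eq_zero H.nondeg_left H.nondeg_left))

theorem rTensor_mulLeft_T₁ (a b c : A) :
    (LinearMap.mulLeft ℂ c).rTensor A (H.T₁ (a ⊗ₜ b)) =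
      (LinearMap.mulRight ℂ b).lTensor A (H.T₂ (c ⊗ₜ a)) := by
  apply H.toMul_tensor_injective
  rw [toMul_rTensor_mulLeft, toMul_lTensor_mulRight, H.T₁_spec, H.T₂_spec, mul_assoc]

theorem Δ_lmul_tmul (x a b : A) :
    (H.Δ x).lmul (a ⊗ₜ b) = (LinearMap.mulRight ℂ a).rTensor A (H.T₁ (x ⊗ₜ b)) := by
  apply H.toMul_tensor_injective
  rw [toMul_lmul, toMul_rTensor_mulRight, H.T₁_spec, toMul_tmul, mul_assoc, tmulMul_mul_tmulMul,
    one_mul, mul_one]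

theorem Δ_rmul_tmul (x a b : A) :
    (H.Δ x).rmul (a ⊗ₜ b) = (LinearMap.mulLeft ℂ b).lTensor A (H.T₂ (a ⊗ₜ x)) := by
  apply H.toMul_tensor_injective
  rw [toMul_rmul, toMul_lTensor_mulLeft, H.T₂_spec, toMul_tmul, ← mul_assoc, tmulMul_mul_tmulMul,
    one_mul, mul_one]

theorem Δ_lmul_eq_rTensor_mul'_delta13Left (x : A) :
    (H.Δ x).lmul = (LinearMap.mul' ℂ A).rTensor A ∘ₗ delta13Left H.T₁ x := by
  refine TensorProduct.ext' fun a b => ?_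
  rw [H.Δ_lmul_tmul, LinearMap.comp_apply, delta13Left_tmul, ← LinearMap.rTensor_comp_apply]
  rfl

theorem Δ_rmul_eq_lTensor_mul'_delta13Right (x : A) :
    (H.Δ x).rmul = (LinearMap.mul' ℂ A).lTensor A ∘ₗ delta13Right H.T₂ x := by
  refine TensorProduct.ext' fun a b => ?_
  rw [H.Δ_rmul_tmul, LinearMap.comp_apply, delta13Right_tmul, ← LinearMap.lTensor_comp_apply]
  rfl

theorem T₁_mul_tmul (x y c : A) :
    H.T₁ ((x * y) ⊗ₜ c) =
      (LinearMap.mul' ℂ A).rTensor A (delta13Left H.T₁ x (H.T₁ (y ⊗ₜ c))) := by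
  have T₁_mul : H.T₁ ((x * y) ⊗ₜ c) = (H.Δ x).lmul (H.T₁ (y ⊗ₜ c)) := by
    apply H.toMul_tensor_injective
    rw [toMul_lmul, H.T₁_spec, H.T₁_spec, H.Δ_mul, mul_assoc]
  rw [T₁_mul, H.Δ_lmul_eq_rTensor_mul'_delta13Left, LinearMap.comp_apply]

theorem T₂_tmul_mul (c x y : A) :
    H.T₂ (c ⊗ₜ (x * y)) =
      (LinearMap.mul' ℂ A).lTensor A (delta13Right H.T₂ y (H.T₂ (c ⊗ₜ x))) := by
  have T₂_mul : H.T₂ (c ⊗ₜ (x * y)) = (H.Δ y).rmul (H.T₂ (c ⊗ₜ x)) := by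
    apply H.toMul_tensor_injective
    rw [toMul_rmul, H.T₂_spec, H.T₂_spec, H.Δ_mul, mul_assoc]
  rw [T₂_mul, H.Δ_rmul_eq_lTensor_mul'_delta13Right, LinearMap.comp_apply]

theorem toMul_rTensor_T₂ (c : A) (t : A ⊗[ℂ] A) :
    toMul ((TensorProduct.curry H.T₂ c).rTensor A t) =
      tmulMul (tmulMul (toMul c) 1) 1 * TensorProduct.lift (tmulMul.compl₁₂ H.Δ toMul) t := by
  induction t using TensorProduct.induction_on with
  | zero => simp only [map_zero, mul_zero]
  | add x y hx hy => simp only [map_add, mul_add, hx, hy]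
  | tmul a b =>
    rw [LinearMap.rTensor_tmul, TensorProduct.curry_apply, toMul_tmul, H.T₂_spec,
      TensorProduct.lift.tmul, LinearMap.compl₁₂_apply, tmulMul_mul_tmulMul, one_mul]

theorem toMul_assoc_rTensor_T₂ (c : A) (t : A ⊗[ℂ] A) :
    toMul (TensorProduct.assoc ℂ A A A ((TensorProduct.curry H.T₂ c).rTensor A t)) =
      tmulMul (toMul c) 1 * deltaId H.Δ t := by
  let assocHom : Multiplier ((A ⊗[ℂ] A) ⊗[ℂ] A) →+* Multiplier (A ⊗[ℂ] (A ⊗[ℂ] A)) :=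
    conjRingHom (TensorProduct.assoc ℂ A A A) (assoc_mul A)
  have tmulMul_toMul_one :
      assocHom (tmulMul (tmulMul (toMul c) 1) 1) = tmulMul (toMul c) 1 := by
    rw [← tmulMul_one_one]
    exact assocMul_tmulMul (toMul c) 1 1
  have assocHom_toMul (s : (A ⊗[ℂ] A) ⊗[ℂ] A) :
      assocHom (toMul s) = toMul (TensorProduct.assoc ℂ A A A s) :=
    conjRingHom_toMul _ (assoc_mul A) s
  have assocHom_lift : assocHom (TensorProduct.lift (tmulMul.compl₁₂ H.Δ toMul) t) =
      deltaId H.Δ t := rfl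
  rw [← assocHom_toMul, H.toMul_rTensor_T₂, map_mul, tmulMul_toMul_one, assocHom_lift]

theorem toMul_lTensor_T₁ (b : A) (t : A ⊗[ℂ] A) :
    toMul (((TensorProduct.curry H.T₁).flip b).lTensor A t) =
      idDelta H.Δ t * tmulMul 1 (tmulMul 1 (toMul b)) := by
  rw [idDelta]
  induction t using TensorProduct.induction_on with
  | zero => simp only [map_zero, zero_mul]
  | add x y hx hy => simp only [map_add, add_mul, hx, hy]
  | tmul c a =>
    rw [LinearMap.lTensor_tmul, LinearMap.flip_apply, TensorProduct.curry_apply, toMul_tmul,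
      H.T₁_spec, TensorProduct.lift.tmul, LinearMap.compl₁₂_apply, tmulMul_mul_tmulMul, mul_one]

/-- Coassociativity, as the commutation of `T₂ ⊗ ι` with `ι ⊗ T₁`. -/
theorem assoc_rTensor_T₂_T₁ (a b c : A) :
    TensorProduct.assoc ℂ A A A ((TensorProduct.curry H.T₂ c).rTensor A (H.T₁ (a ⊗ₜ b))) =
      ((TensorProduct.curry H.T₁).flip b).lTensor A (H.T₂ (c ⊗ₜ a)) := by
  apply H.toMul_tensor₃_injective
  rw [toMul_assoc_rTensor_T₂, toMul_lTensor_T₁, H.coassoc]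

theorem T₂_tmul_idFun_T₁ (f : A →ₗ[ℂ] ℂ) (a b c : A) :
    H.T₂ (c ⊗ₜ idFun f (H.T₁ (a ⊗ₜ b))) =
      (idFun f ∘ₗ (TensorProduct.curry H.T₁).flip b).lTensor A (H.T₂ (c ⊗ₜ a)) := by
  rw [LinearMap.lTensor_comp_apply, ← H.assoc_rTensor_T₂_T₁, lTensor_idFun_assoc_rTensor,
    TensorProduct.curry_apply]

theorem T₁_funId_T₂_tmul (f : A →ₗ[ℂ] ℂ) (a b c : A) :
    H.T₁ (funId f (H.T₂ (c ⊗ₜ a)) ⊗ₜ b) =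
      (funId f ∘ₗ TensorProduct.curry H.T₂ c).rTensor A (H.T₁ (a ⊗ₜ b)) := by
  rw [LinearMap.rTensor_comp_apply,
    (LinearEquiv.eq_symm_apply _).2 (H.assoc_rTensor_T₂_T₁ a b c),
    rTensor_funId_assoc_symm_lTensor, LinearMap.flip_apply, TensorProduct.curry_apply]

end WeakMultiplierHopf

section ModuleAlgebras

variable {A R : Type*} [NonUnitalRing A] [Module ℂ A] [IsScalarTower ℂ A A]
  [SMulCommClass ℂ A A] [NonUnitalRing R] [Module ℂ R] [IsScalarTower ℂ R R]
  [SMulCommClass ℂ R R] {H : WeakMultiplierHopf A}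

theorem IsLeftModuleAlgebra.of_act_act_mul_act {act : A →ₗ[ℂ] R →ₗ[ℂ] R}
    (mul_act : ∀ a b x, act (a * b) x = act a (act b x))
    (unital : Function.Surjective (TensorProduct.lift act))
    (act_act_mul_act : ∀ a p q x y, act a (act p x * act q y) =
      LinearMap.mul' ℂ R (TensorProduct.map₂ act act ((H.Δ a).lmul (p ⊗ₜ q)) (x ⊗ₜ y))) :
    IsLeftModuleAlgebra H act where
  mul_act := mul_act
  unital := unital
  act_mul a x y s := by
    rintro ⟨w, hw, rfl⟩
    have act_mul' : act a ∘ₗ LinearMap.mul' ℂ R ∘ₗ TensorProduct.lift (TensorProduct.map₂ act act) =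
        LinearMap.mul' ℂ R ∘ₗ TensorProduct.lift (TensorProduct.map₂ act act) ∘ₗ
          (H.Δ a).lmul.rTensor (R ⊗[ℂ] R) :=
      TensorProduct.ext_fourfold' (act_act_mul_act a)
    rw [← LinearMap.mul'_apply (R := ℂ), ← hw]
    exact LinearMap.congr_fun act_mul' w

theorem IsRightModuleAlgebra.of_act_act_mul_act {act : R →ₗ[ℂ] A →ₗ[ℂ] R}
    (act_mul : ∀ a b x, act x (a * b) = act (act x a) b)
    (unital : Function.Surjective (TensorProduct.lift act))
    (act_act_mul_act : ∀ a p q x y, act (act x p * act y q) a =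
      LinearMap.mul' ℂ R (TensorProduct.map₂ act act (x ⊗ₜ y) ((H.Δ a).rmul (p ⊗ₜ q)))) :
    IsRightModuleAlgebra H act where
  act_mul := act_mul
  unital := unital
  mul_act a x y s := by
    rintro ⟨w, hw, rfl⟩
    have mul'_act : act.flip a ∘ₗ LinearMap.mul' ℂ R ∘ₗ
          TensorProduct.lift (TensorProduct.map₂ act act) =
        LinearMap.mul' ℂ R ∘ₗ TensorProduct.lift (TensorProduct.map₂ act act) ∘ₗ
          (H.Δ a).rmul.lTensor (R ⊗[ℂ] R) :=
      TensorProduct.ext_fourfold' fun x y p q => act_act_mul_act a p q x y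
    rw [← LinearMap.mul'_apply (R := ℂ), ← hw]
    exact LinearMap.congr_fun mul'_act w

end ModuleAlgebras

section Pairings

variable {A B : Type*} [NonUnitalRing A] [Module ℂ A] [IsScalarTower ℂ A A] [SMulCommClass ℂ A A]
  [NonUnitalRing B] [Module ℂ B] [IsScalarTower ℂ B B] [SMulCommClass ℂ B B]
  {HA : RegularWeakMultiplierHopf A} {HB : RegularWeakMultiplierHopf B}

namespace SliceForm

variable (P : SliceForm HA HB)

/-- The form `⟨b, a⟩ := ⟨a, b⟩` on `B × A`, which exchanges `leftAB` with `leftBA` and `rightAB`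
with `rightBA`. -/
def swap : SliceForm HB HA where
  form := P.form.flip
  funId_B := P.funId_A
  idFun_B := P.idFun_A
  funId_A := P.funId_B
  idFun_A := P.idFun_B

/-- The pairing `⟨u ⊗ v, c ⊗ d⟩ = ⟨u, c⟩⟨v, d⟩` of `A ⊗ A` with `B ⊗ B`. -/
def tensorForm : A ⊗[ℂ] A →ₗ[ℂ] B ⊗[ℂ] B →ₗ[ℂ] ℂ :=
  TensorProduct.dualDistrib ℂ B B ∘ₗ TensorProduct.map P.form P.form

theorem tensorForm_tmul_tmul (u v : A) (c d : B) :
    P.tensorForm (u ⊗ₜ v) (c ⊗ₜ d) = P.form u c * P.form v d := rfl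

theorem mul_leftAB (a : A) (b c : B) :
    c * P.leftAB a b = idFun (P.form a) (HB.T₂ (c ⊗ₜ b)) :=
  ((P.idFun_B a b).choose_spec c).2

theorem rightAB_mul (a : A) (b c : B) :
    P.rightAB b a * c = funId (P.form a) (HB.T₁ (b ⊗ₜ c)) :=
  ((P.funId_B a b).choose_spec c).1

theorem idFun_mul_leftAB (u v : A) (d : B) (t : B ⊗[ℂ] B) :
    idFun (P.form u) t * P.leftAB v d =
      TensorProduct.rid ℂ B
        ((P.tensorForm (u ⊗ₜ v)).lTensor B (delta13Right HB.T₂ d t)) := by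
  induction t using TensorProduct.induction_on with
  | zero => simp
  | add x y hx hy => simp only [map_add, add_mul, hx, hy]
  | tmul f g =>
    have tensorForm_comp_mk :
        P.tensorForm (u ⊗ₜ v) ∘ₗ TensorProduct.mk ℂ B B g = P.form u g • P.form v := rfl
    rw [idFun_tmul, smul_mul_assoc, P.mul_leftAB, delta13Right_tmul,
      ← LinearMap.lTensor_comp_apply, tensorForm_comp_mk, ← idFun_smul]
    rfl

theorem rightAB_mul_funId (u v : A) (c : B) (t : B ⊗[ℂ] B) :
    P.rightAB c u * funId (P.form v) t =
      TensorProduct.lid ℂ B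
        ((P.tensorForm (u ⊗ₜ v)).rTensor B (delta13Left HB.T₁ c t)) := by
  induction t using TensorProduct.induction_on with
  | zero => simp
  | add x y hx hy => simp only [map_add, mul_add, hx, hy]
  | tmul g f =>
    have tensorForm_comp_mk : P.tensorForm (u ⊗ₜ v) ∘ₗ (TensorProduct.mk ℂ B B).flip g =
        P.form v g • P.form u := LinearMap.ext fun _ => mul_comm _ _
    rw [funId_tmul, mul_smul_comm, P.rightAB_mul, delta13Left_tmul,
      ← LinearMap.rTensor_comp_apply, tensorForm_comp_mk, ← funId_smul]
    rfl

theorem mul_mul'_map₂_leftAB (w : A ⊗[ℂ] A) (c d e : B) :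
    e * LinearMap.mul' ℂ B (TensorProduct.map₂ P.leftAB P.leftAB w (c ⊗ₜ d)) =
      TensorProduct.rid ℂ B
        ((P.tensorForm w).lTensor B (delta13Right HB.T₂ d (HB.T₂ (e ⊗ₜ c)))) := by
  induction w using TensorProduct.induction_on with
  | zero => simp
  | add x y hx hy =>
    simp only [map_add, LinearMap.add_apply, LinearMap.lTensor_add, mul_add, hx, hy]
  | tmul u v =>
    rw [← P.idFun_mul_leftAB, ← P.mul_leftAB, TensorProduct.map₂_apply_tmul,
      TensorProduct.map_tmul, LinearMap.mul'_apply, mul_assoc]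

theorem mul'_map₂_rightAB_mul (w : A ⊗[ℂ] A) (c d e : B) :
    LinearMap.mul' ℂ B (TensorProduct.map₂ P.rightAB P.rightAB (c ⊗ₜ d) w) * e =
      TensorProduct.lid ℂ B
        ((P.tensorForm w).rTensor B (delta13Left HB.T₁ c (HB.T₁ (d ⊗ₜ e)))) := by
  induction w using TensorProduct.induction_on with
  | zero => simp
  | add x y hx hy =>
    simp only [map_add, LinearMap.add_apply, LinearMap.rTensor_add, add_mul, hx, hy]
  | tmul u v =>
    rw [← P.rightAB_mul_funId, ← P.rightAB_mul, TensorProduct.map₂_apply_tmul,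
      TensorProduct.map_tmul, LinearMap.mul'_apply, mul_assoc]

end SliceForm

namespace PrePairing

variable (P : PrePairing HA HB)

/-- The pre-pairing `⟨b, a⟩ := ⟨a, b⟩` of `B` and `A`, see `SliceForm.swap`. -/
def swap : PrePairing HB HA where
  toSliceForm := P.toSliceForm.swap
  form_leftAB b b' a := P.form_leftBA a b b'
  form_rightAB b b' a := P.form_rightBA a b b'
  form_leftBA b a a' := P.form_leftAB a a' b
  form_rightBA b a a' := P.form_rightAB a a' b

theorem leftAB_leftBA (a : A) (b : B) :
    P.leftAB (P.leftBA b a) = idFun (P.form a) ∘ₗ (TensorProduct.curry HB.T₁).flip b := by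
  refine LinearMap.ext fun x => HB.eq_of_mul_left fun c => ?_
  have form_leftBA_eq : P.form (P.leftBA b a) = P.form a ∘ₗ LinearMap.mulRight ℂ b :=
    LinearMap.ext fun y => P.form_leftBA a y b
  calc c * P.leftAB (P.leftBA b a) x
      = idFun (P.form a) ((LinearMap.mulRight ℂ b).lTensor B (HB.T₂ (c ⊗ₜ x))) := by
        rw [P.mul_leftAB, form_leftBA_eq, idFun_comp]
    _ = idFun (P.form a) ((LinearMap.mulLeft ℂ c).rTensor B (HB.T₁ (x ⊗ₜ b))) := by
        rw [HB.rTensor_mulLeft_T₁]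
    _ = c * idFun (P.form a) (HB.T₁ (x ⊗ₜ b)) := rid_lTensor_rTensor _ _ _

theorem flip_rightAB_rightBA (a : A) (b : B) :
    P.rightAB.flip (P.rightBA a b) = funId (P.form a) ∘ₗ TensorProduct.curry HB.T₂ b := by
  refine LinearMap.ext fun x => eq_of_mul_right HB fun c => ?_
  have form_rightBA_eq : P.form (P.rightBA a b) = P.form a ∘ₗ LinearMap.mulLeft ℂ b :=
    LinearMap.ext fun y => P.form_rightBA a b y
  calc P.rightAB x (P.rightBA a b) * c
      = funId (P.form a) ((LinearMap.mulLeft ℂ b).rTensor B (HB.T₁ (x ⊗ₜ c))) := by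
        rw [P.rightAB_mul, form_rightBA_eq, funId_comp]
    _ = funId (P.form a) ((LinearMap.mulRight ℂ c).lTensor B (HB.T₂ (b ⊗ₜ x))) := by
        rw [HB.rTensor_mulLeft_T₁]
    _ = funId (P.form a) (HB.T₂ (b ⊗ₜ x)) * c := lid_rTensor_lTensor _ _ _

theorem T₂_tmul_leftAB (hBA : Function.Surjective (TensorProduct.lift P.leftBA)) (a : A) (b c : B) :
    HB.T₂ (c ⊗ₜ P.leftAB a b) = (P.leftAB a).lTensor B (HB.T₂ (c ⊗ₜ b)) := by
  obtain ⟨w, rfl⟩ := hBA a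
  induction w using TensorProduct.induction_on with
  | zero => simp
  | add x y hx hy =>
    simp only [map_add, LinearMap.add_apply, TensorProduct.tmul_add, LinearMap.lTensor_add, hx, hy]
  | tmul b' a' =>
    rw [TensorProduct.lift.tmul, P.leftAB_leftBA]
    exact HB.T₂_tmul_idFun_T₁ (P.form a') b b' c

theorem T₁_rightAB_tmul (hBA : Function.Surjective (TensorProduct.lift P.rightBA)) (a : A)
    (b c : B) :
    HB.T₁ (P.rightAB b a ⊗ₜ c) = (P.rightAB.flip a).rTensor B (HB.T₁ (b ⊗ₜ c)) := by
  obtain ⟨w, rfl⟩ := hBA a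
  induction w using TensorProduct.induction_on with
  | zero => simp
  | add x y hx hy =>
    simp only [map_add, LinearMap.add_apply, TensorProduct.add_tmul, LinearMap.rTensor_add, hx, hy]
  | tmul a' b' =>
    rw [TensorProduct.lift.tmul, P.flip_rightAB_rightBA, ← LinearMap.flip_apply P.rightAB,
      P.flip_rightAB_rightBA]
    exact HB.T₁_funId_T₂_tmul (P.form a') b c b'

theorem leftAB_mul (hBA : Function.Surjective (TensorProduct.lift P.leftBA)) (a a' : A) (b : B) :
    P.leftAB (a * a') b = P.leftAB a (P.leftAB a' b) := by
  refine HB.eq_of_mul_left fun c => ?_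
  have form_mul : P.form (a * a') = P.form a ∘ₗ P.leftAB a' :=
    LinearMap.ext fun y => (P.form_leftAB a a' y).symm
  rw [P.mul_leftAB, P.mul_leftAB, P.T₂_tmul_leftAB hBA, form_mul, idFun_comp]

theorem rightAB_mul_right (hBA : Function.Surjective (TensorProduct.lift P.rightBA)) (a a' : A)
    (b : B) : P.rightAB b (a * a') = P.rightAB (P.rightAB b a) a' := by
  refine eq_of_mul_right HB fun c => ?_
  have form_mul : P.form (a * a') = P.form a' ∘ₗ P.rightAB.flip a :=
    LinearMap.ext fun y => (P.form_rightAB a a' y).symm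
  rw [P.rightAB_mul, P.rightAB_mul, P.T₁_rightAB_tmul hBA, form_mul, funId_comp]

theorem form_comp_mul'_map_leftAB (a p q : A) :
    P.form a ∘ₗ LinearMap.mul' ℂ B ∘ₗ TensorProduct.map (P.leftAB p) (P.leftAB q) =
      P.tensorForm ((HA.Δ a).lmul (p ⊗ₜ q)) := by
  refine TensorProduct.ext' fun c d => ?_
  have funId_form (t : A ⊗[ℂ] A) : P.form (funId (P.form.flip (P.leftAB p c)) t) d =
      P.tensorForm ((LinearMap.mulRight ℂ p).rTensor A t) (c ⊗ₜ d) := by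
    induction t using TensorProduct.induction_on with
    | zero => simp
    | add x y hx hy => simp only [map_add, LinearMap.add_apply, hx, hy]
    | tmul u v => simp [funId_tmul, P.tensorForm_tmul_tmul, P.form_leftAB]
  calc P.form a (P.leftAB p c * P.leftAB q d)
      = P.form (P.rightBA a (P.leftAB p c) * q) d := by rw [← P.form_rightBA, P.form_leftAB]
    _ = P.form (funId (P.form.flip (P.leftAB p c)) (HA.T₁ (a ⊗ₜ q))) d :=
        congrArg (P.form · d) (P.toSliceForm.swap.rightAB_mul (P.leftAB p c) a q)
    _ = P.tensorForm ((HA.Δ a).lmul (p ⊗ₜ q)) (c ⊗ₜ d) := by rw [funId_form, HA.Δ_lmul_tmul]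

theorem form_comp_mul'_map_rightAB (a p q : A) :
    P.form a ∘ₗ LinearMap.mul' ℂ B ∘ₗ TensorProduct.map (P.rightAB.flip p) (P.rightAB.flip q) =
      P.tensorForm ((HA.Δ a).rmul (p ⊗ₜ q)) := by
  refine TensorProduct.ext' fun c d => ?_
  have idFun_form (t : A ⊗[ℂ] A) : P.form (idFun (P.form.flip (P.rightAB d q)) t) c =
      P.tensorForm ((LinearMap.mulLeft ℂ q).lTensor A t) (c ⊗ₜ d) := by
    induction t using TensorProduct.induction_on with
    | zero => simp
    | add x y hx hy => simp only [map_add, LinearMap.add_apply, hx, hy]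
    | tmul u v => simp [idFun_tmul, P.tensorForm_tmul_tmul, P.form_rightAB, mul_comm]
  calc P.form a (P.rightAB c p * P.rightAB d q)
      = P.form (p * P.leftBA (P.rightAB d q) a) c := by rw [← P.form_leftBA, P.form_rightAB]
    _ = P.form (idFun (P.form.flip (P.rightAB d q)) (HA.T₂ (p ⊗ₜ a))) c :=
        congrArg (P.form · c) (P.toSliceForm.swap.mul_leftAB (P.rightAB d q) a p)
    _ = P.tensorForm ((HA.Δ a).rmul (p ⊗ₜ q)) (c ⊗ₜ d) := by rw [idFun_form, HA.Δ_rmul_tmul]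

theorem leftAB_leftAB_mul_leftAB (hBA : Function.Surjective (TensorProduct.lift P.leftBA))
    (a p q : A) (c d : B) :
    P.leftAB a (P.leftAB p c * P.leftAB q d) = LinearMap.mul' ℂ B
      (TensorProduct.map₂ P.leftAB P.leftAB ((HA.Δ a).lmul (p ⊗ₜ q)) (c ⊗ₜ d)) := by
  refine HB.eq_of_mul_left fun e => ?_
  rw [P.mul_leftAB, HB.T₂_tmul_mul, P.T₂_tmul_leftAB hBA,
    delta13Right_lTensor _ fun _ => P.T₂_tmul_leftAB hBA _ _ _, P.mul_mul'_map₂_leftAB,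
    ← P.form_comp_mul'_map_leftAB, LinearMap.lTensor_comp_apply, LinearMap.lTensor_comp_apply]
  rfl

theorem rightAB_rightAB_mul_rightAB (hBA : Function.Surjective (TensorProduct.lift P.rightBA))
    (a p q : A) (c d : B) :
    P.rightAB (P.rightAB c p * P.rightAB d q) a = LinearMap.mul' ℂ B
      (TensorProduct.map₂ P.rightAB P.rightAB (c ⊗ₜ d) ((HA.Δ a).rmul (p ⊗ₜ q))) := by
  refine eq_of_mul_right HB fun e => ?_
  rw [P.rightAB_mul, HB.T₁_mul_tmul, P.T₁_rightAB_tmul hBA, ← LinearMap.flip_apply P.rightAB,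
    delta13Left_rTensor _ fun _ => P.T₁_rightAB_tmul hBA _ _ _, P.mul'_map₂_rightAB_mul,
    ← P.form_comp_mul'_map_rightAB, LinearMap.rTensor_comp_apply, LinearMap.rTensor_comp_apply]
  rfl

theorem isLeftModuleAlgebra_leftAB (hAB : Function.Surjective (TensorProduct.lift P.leftAB))
    (hBA : Function.Surjective (TensorProduct.lift P.leftBA)) :
    IsLeftModuleAlgebra HA.toWeakMultiplierHopf P.leftAB :=
  .of_act_act_mul_act (P.leftAB_mul hBA) hAB (P.leftAB_leftAB_mul_leftAB hBA)

theorem isRightModuleAlgebra_rightAB (hAB : Function.Surjective (TensorProduct.lift P.rightAB))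
    (hBA : Function.Surjective (TensorProduct.lift P.rightBA)) :
    IsRightModuleAlgebra HA.toWeakMultiplierHopf P.rightAB :=
  .of_act_act_mul_act (P.rightAB_mul_right hBA) hAB (P.rightAB_rightAB_mul_rightAB hBA)

end PrePairing

end Pairings

end WMHopf

end

theorem mainTheorem10 {A B : Type*}
    [NonUnitalRing A] [Module ℂ A] [IsScalarTower ℂ A A] [SMulCommClass ℂ A A]
    [NonUnitalRing B] [Module ℂ B] [IsScalarTower ℂ B B] [SMulCommClass ℂ B B]
    (HA : WMHopf.RegularWeakMultiplierHopf A) (HB : WMHopf.RegularWeakMultiplierHopf B)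
    (P : WMHopf.Pairing HA HB) :
    WMHopf.IsLeftModuleAlgebra HA.toWeakMultiplierHopf P.leftAB ∧
    WMHopf.IsRightModuleAlgebra HA.toWeakMultiplierHopf P.rightAB ∧
    WMHopf.IsLeftModuleAlgebra HB.toWeakMultiplierHopf P.leftBA ∧
    WMHopf.IsRightModuleAlgebra HB.toWeakMultiplierHopf P.rightBA :=
  ⟨P.isLeftModuleAlgebra_leftAB P.surj_leftAB P.surj_leftBA,
    P.isRightModuleAlgebra_rightAB P.surj_rightAB P.surj_rightBA,
    P.swap.isLeftModuleAlgebra_leftAB P.surj_leftBA P.surj_leftAB,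
    P.swap.isRightModuleAlgebra_rightAB P.surj_rightBA P.surj_rightAB⟩
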